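/- Let $k$ be a field of characteristic $p>0$ (possibly finite), and let $\mathfrak g$ be a finite-dimensional restricted Lie algebra over $k$, that is, a finite-dimensional Lie algebra with a map $x\mapsto x^{[p]}$ such that, for all $x,y\in\mathfrak g$ and $a\in k$, $\operatorname{ad}(x^{[p]})=(\operatorname{ad}x)^p$, $(ax)^{[p]}=a^p x^{[p]}$ and $(x+y)^{[p]}=x^{[p]}+y^{[p]}+\sum_{i=1}^{p-1}s_i(x,y)$, where $i\,s_i(x,y)$ is the coefficient of $\lambda^{i-1}$ in $(\operatorname{ad}(\lambda x+y))^{p-1}(x)$, with $\lambda$ an indeterminate. Then $\mathfrak g$ is spanned, as a $k$-vector space, by the union of its Cartan subalgebras, that is, of its nilpotent Lie subalgebras $\mathfrak c$ that are equal to their normaliser $\{x\in\mathfrak g : [x,\mathfrak c]\subseteq\mathfrak c\}$ in $\mathfrak g$. -/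

import Mathlib

/-- The Jacobson term `s_i(x, y)` for `1 ≤ i ≤ p - 1`: the element of `L` such that
`i • s_i(x, y)` is the coefficient of `λ ^ (i - 1)` in `(ad (λ x + y)) ^ (p - 1) (x)`, with `λ`
an indeterminate. Here `λ ad x + ad y` is a polynomial in `λ = X` (which commutes with the
coefficients) over the associative ring of `k`-linear endomorphisms of `L`. -/
noncomputable def jacobsonTerm (p : ℕ) (k : Type*) {L : Type*} [Field k] [LieRing L]
    [LieAlgebra k L] (i : ℕ) (x y : L) : L :=
  (i : k)⁻¹ •
    (((Polynomial.X * Polynomial.C (LieAlgebra.ad k L x : Module.End k L) +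
        Polynomial.C (LieAlgebra.ad k L y : Module.End k L)) ^ (p - 1)).coeff (i - 1)) x

/-- A restricted Lie algebra over a field `k` of characteristic `p > 0`: a Lie algebra with a
`p`-map `x ↦ x^[p]` in the sense of Jacobson. -/
class RestrictedLieAlgebra (p : ℕ) (k : Type*) (L : Type*) [Field k] [LieRing L]
    [LieAlgebra k L] where
  /-- The `p`-map `x ↦ x^[p]`. -/
  pMap : L → L
  /-- `ad (x^[p]) = (ad x) ^ p`. -/
  ad_pMap : ∀ x : L,
    (LieAlgebra.ad k L (pMap x) : Module.End k L) = (LieAlgebra.ad k L x : Module.End k L) ^ p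
  /-- `(a x)^[p] = a ^ p x^[p]`. -/
  pMap_smul : ∀ (a : k) (x : L), pMap (a • x) = a ^ p • pMap x
  /-- `(x + y)^[p] = x^[p] + y^[p] + ∑ s_i(x, y)`, the sum over `1 ≤ i ≤ p - 1`. -/
  pMap_add : ∀ x y : L,
    pMap (x + y) = pMap x + pMap y + ∑ i ∈ Finset.Icc 1 (p - 1), jacobsonTerm p k i x y

/-!
The proof is by induction on the dimension and rests on two facts.

*A finite-dimensional Lie algebra `L` over any field which is not nilpotent is spanned by the
elements `x` with `ad x` not nilpotent* (`LieAlgebra.span_not_isNilpotent_ad_eq_top`). Suppose these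
elements lie in a proper subspace `V`. Among the subalgebras that act nilpotently on `L` and are
not contained in `V`, choose a maximal one, `K`. If `K ≠ L`, then by Engel's theorem some `x ∉ K`
normalizes `K`; adding an element of `K` outside `V` if necessary, one may take `x ∉ V`, so that
`ad x` is nilpotent. But then `K + k x` acts nilpotently too, against maximality. So `K = L`, and
`L` is nilpotent. This argument does not see the size of the field, in contrast with the
density of regular elements.

*If `L` is restricted, the Engel subalgebra of `x` is the centralizer of a single element `s`*,
namely `s = x^[p]^N` with `N` large, since `ad s = (ad x) ^ (p ^ N)`. A Cartan subalgebra of this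
centralizer contains the central element `s`, and is therefore self-normalizing in `L`, so a Cartan
subalgebra of `L` (`LieSubalgebra.isCartanSubalgebra_map_incl`).

Hence if `L` is not nilpotent, it is spanned by the elements `x` with `ad x` not nilpotent, each of
which lies in its proper Engel subalgebra, where induction applies; and if `L` is nilpotent, it is a
Cartan subalgebra of itself. The induction carries the condition that each `(ad x) ^ p`
is an inner derivation, which passes to the centralizer of `s`: if `x` commutes with `s`, then so
does any `x'` with `ad x' = (ad x) ^ p`.
-/

/-- Adjoining to a subalgebra that acts nilpotently on `L` an element of its normalizer with
nilpotent adjoint action gives a subalgebra that acts nilpotently on `L`. -/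
theorem LieSubalgebra.exists_isNilpotent_of_mem_normalizer {R L : Type*} [CommRing R] [LieRing L]
    [LieAlgebra R L] {K : LieSubalgebra R L} (hK : LieModule.IsNilpotent K L) {x : L}
    (hx : x ∈ K.normalizer) (hxn : IsNilpotent (LieAlgebra.ad R L x)) :
    ∃ K' : LieSubalgebra R L, K ≤ K' ∧ x ∈ K' ∧ LieModule.IsNilpotent K' L := by
  let K' : LieSubalgebra R L :=
    { (R ∙ x) ⊔ (K : Submodule R L) with
      lie_mem' := fun {y z} => LieSubalgebra.lie_mem_sup_of_mem_normalizer hx }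
  have hxK' : x ∈ K' := Submodule.mem_sup_left (Submodule.mem_span_singleton_self x)
  have hKK' : K ≤ K' := (LieSubalgebra.toSubmodule_le_toSubmodule K K').mp le_sup_right
  have hK' : K' ≤ K.normalizer := by
    rw [← LieSubalgebra.toSubmodule_le_toSubmodule]
    exact sup_le ((Submodule.span_singleton_le_iff_mem _ _).mpr hx) K.le_normalizer
  refine ⟨K', hKK', hxK', ?_⟩
  obtain ⟨I, hI : (I : LieSubalgebra R K') = LieSubalgebra.ofLe hKK'⟩ :=
    LieSubalgebra.exists_nested_lieIdeal_ofLe_normalizer hKK' hK'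
  have hsup : R ∙ (⟨x, hxK'⟩ : K') ⊔ LieSubmodule.toSubmodule I = ⊤ := by
    rw [← LieIdeal.toLieSubalgebra_toSubmodule R K' I, hI]
    apply Submodule.map_injective_of_injective (K' : Submodule R L).injective_subtype
    simp only [LieSubalgebra.coe_ofLe, Submodule.map_sup, Submodule.map_subtype_range_inclusion,
      Submodule.map_top, Submodule.range_subtype]
    rw [Submodule.map_subtype_span_singleton]
  let e : K ≃ₗ⁅R⁆ I :=
    (LieSubalgebra.equivOfLe hKK').trans
      (LieEquiv.ofEq _ _ ((LieSubalgebra.coe_set_eq _ _).mpr hI.symm))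
  have hIn : LieModule.IsNilpotent I L :=
    (Equiv.lieModule_isNilpotent_iff e (1 : L ≃ₗ[R] L) fun _ _ => rfl).mp hK
  exact LieSubmodule.isNilpotentOfIsNilpotentSpanSupEqTop hsup hxn hIn

/-- A proper subalgebra that acts nilpotently on `L` is properly contained in its normalizer. -/
theorem LieSubalgebra.exists_mem_normalizer_notMem {R L : Type*} [CommRing R] [LieRing L]
    [LieAlgebra R L] {K : LieSubalgebra R L} (hK : LieModule.IsNilpotent K L) (hne : K ≠ ⊤) :
    ∃ x ∈ K.normalizer, x ∉ K := by
  refine SetLike.exists_of_lt (lt_of_le_of_ne K.le_normalizer ?_)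
  rw [Ne, eq_comm, K.normalizer_eq_self_iff, ← Ne, ← LieSubmodule.nontrivial_iff_ne_bot R K]
  have : Nontrivial (L ⧸ K.toLieSubmodule) := Submodule.Quotient.nontrivial_iff.2 <| by simpa
  have : LieModule.IsNilpotent K (L ⧸ K.toLieSubmodule) := by
    obtain ⟨n, hn⟩ := (LieModule.isNilpotent_iff R K L).mp hK
    exact (LieModule.isNilpotent_quotient_iff R K L _).mpr ⟨n, hn ▸ bot_le⟩
  exact LieModule.nontrivial_max_triv_of_isNilpotent R K (L ⧸ K.toLieSubmodule)

theorem LieAlgebra.span_not_isNilpotent_ad_eq_top {k L : Type*} [Field k] [LieRing L]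
    [LieAlgebra k L] [FiniteDimensional k L] (hL : ¬ LieRing.IsNilpotent L) :
    Submodule.span k {x : L | ¬ IsNilpotent (LieAlgebra.ad k L x)} = ⊤ := by
  set V := Submodule.span k {x : L | ¬ IsNilpotent (LieAlgebra.ad k L x)}
  by_contra hne
  have hnil : ∀ x ∉ V, IsNilpotent (LieAlgebra.ad k L x) := fun x hx => by
    by_contra h
    exact hx (Submodule.subset_span h)
  let S := {K : LieSubalgebra k L | LieModule.IsNilpotent K L ∧ ∃ b ∈ K, b ∉ V}
  have hS : S.Nonempty := by
    obtain ⟨y, -, hy⟩ := SetLike.exists_of_lt (lt_top_iff_ne_top.mpr hne)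
    have hbot : LieModule.IsNilpotent (⊥ : LieSubalgebra k L) L := by
      rw [LieModule.isNilpotent_iff_forall (R := k)]
      rintro ⟨x, hx⟩
      obtain rfl := (LieSubalgebra.mem_bot x).mp hx
      exact ⟨1, by ext; simp⟩
    have hyn : y ∈ (⊥ : LieSubalgebra k L).normalizer := by
      simp [LieSubalgebra.mem_normalizer_iff]
    obtain ⟨K, -, hyK, hK⟩ :=
      LieSubalgebra.exists_isNilpotent_of_mem_normalizer hbot hyn (hnil y hy)
    exact ⟨K, hK, y, hyK, hy⟩
  obtain ⟨K, ⟨hK, b, hbK, hbV⟩, hmax⟩ :=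
    (LieSubalgebra.wellFoundedGT_of_noetherian k L).wf.has_min S hS
  have htop : K ≠ ⊤ := by
    rintro rfl
    exact hL (LieModule.isNilpotent_of_top_iff (R := k).mp hK)
  obtain ⟨z, hz, hzK⟩ := LieSubalgebra.exists_mem_normalizer_notMem hK htop
  obtain ⟨x, hx, hxK, hxV⟩ : ∃ x ∈ K.normalizer, x ∉ K ∧ x ∉ V := by
    by_cases hzV : z ∈ V
    · exact ⟨z + b, add_mem hz (K.le_normalizer hbK), fun h => hzK ((add_mem_cancel_right hbK).mp h),
        fun h => hbV ((add_mem_cancel_left hzV).mp h)⟩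
    · exact ⟨z, hz, hzK, hzV⟩
  obtain ⟨K', hle, hxK', hK'⟩ :=
    LieSubalgebra.exists_isNilpotent_of_mem_normalizer hK hx (hnil x hxV)
  exact hmax K' ⟨hK', b, hle hbK, hbV⟩ (lt_of_le_of_ne hle fun h => hxK (h ▸ hxK'))

/-- If `e` is the centralizer of `s` and `ad s` acts injectively on `L / e`, then Cartan subalgebras
of `e` are Cartan subalgebras of `L`: they contain the central element `s` of `e`, so the bracket
of `s` with any element normalizing one of them lies in `e`. -/
theorem LieSubalgebra.isCartanSubalgebra_map_incl {R L : Type*} [CommRing R] [LieRing L]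
    [LieAlgebra R L] {e : LieSubalgebra R L} {s : L} (hs : ∀ y, y ∈ e ↔ ⁅s, y⁆ = 0)
    (hs2 : ∀ y, ⁅s, y⁆ ∈ e → y ∈ e) (H : LieSubalgebra R e) [H.IsCartanSubalgebra] :
    (H.map e.incl).IsCartanSubalgebra where
  nilpotent := by
    have hH : LieRing.IsNilpotent H := IsCartanSubalgebra.nilpotent
    exact (LieEquiv.nilpotent_iff_equiv_nilpotent (R := R)
      (H.equivMapOfInjective (f := e.incl) Subtype.val_injective)).mp hH
  self_normalizing := by
    refine le_antisymm (fun x hx => ?_) (H.map e.incl).le_normalizer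
    rw [mem_normalizer_iff] at hx
    have hse : s ∈ e := (hs s).mpr (lie_self s)
    have hsH : (⟨s, hse⟩ : e) ∈ H := by
      rw [← IsCartanSubalgebra.self_normalizing (H := H), mem_normalizer_iff]
      intro y _
      have h0 : ⁅(⟨s, hse⟩ : e), y⁆ = 0 := Subtype.ext ((hs y).mp y.2)
      rw [h0]
      exact H.zero_mem
    have hxe : x ∈ e := by
      obtain ⟨u, -, hu⟩ := (mem_map _ _ _).mp (hx s ((mem_map _ _ _).mpr ⟨_, hsH, rfl⟩))
      apply hs2
      rw [← lie_skew, ← hu]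
      exact neg_mem u.2
    have hxH : (⟨x, hxe⟩ : e) ∈ H := by
      rw [← IsCartanSubalgebra.self_normalizing (H := H), mem_normalizer_iff]
      intro y hy
      obtain ⟨u, hu, huy⟩ := (mem_map _ _ _).mp (hx y ((mem_map _ _ _).mpr ⟨y, hy, rfl⟩))
      have h0 : ⁅(⟨x, hxe⟩ : e), y⁆ = u := Subtype.ext huy.symm
      rwa [h0]
    exact (mem_map _ _ _).mpr ⟨_, hxH, rfl⟩

theorem LieAlgebra.exists_ad_eq_ad_pow_pow {R L : Type*} [CommRing R] [LieRing L]
    [LieAlgebra R L] {p : ℕ} (h : ∀ x : L, ∃ x' : L, (ad R L x' : Module.End R L) = ad R L x ^ p)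
    (x : L) (n : ℕ) : ∃ s : L, (ad R L s : Module.End R L) = ad R L x ^ p ^ n := by
  induction n with
  | zero => exact ⟨x, by simp⟩
  | succ n ih =>
    obtain ⟨s, hs⟩ := ih
    obtain ⟨s', hs'⟩ := h s
    exact ⟨s', by rw [hs', hs, ← pow_mul, pow_succ]⟩

/-- If all `p`-th powers of inner derivations are inner, then the Engel subalgebra of `x` is the
centralizer of an element `s`. Since `ad s` is a power of `ad x`, it acts injectively modulo
the Engel subalgebra. -/
theorem LieSubalgebra.exists_mem_engel_iff_lie_eq_zero {k L : Type*} [Field k] [LieRing L]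
    [LieAlgebra k L] [FiniteDimensional k L] {p : ℕ} (hp : 1 < p)
    (h : ∀ x : L, ∃ x' : L, (LieAlgebra.ad k L x' : Module.End k L) = LieAlgebra.ad k L x ^ p)
    (x : L) : ∃ s : L, (∀ y, y ∈ engel k x ↔ ⁅s, y⁆ = 0) ∧
      ∀ y, ⁅s, y⁆ ∈ engel k x → y ∈ engel k x := by
  obtain ⟨s, hs⟩ := LieAlgebra.exists_ad_eq_ad_pow_pow h x (Module.finrank k L)
  have hle : Module.finrank k L ≤ p ^ Module.finrank k L := (Nat.lt_pow_self hp).le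
  refine ⟨s, fun y => ?_, fun y hy => ?_⟩
  · rw [mem_engel_iff, ← LieAlgebra.ad_apply (R := k), hs]
    refine ⟨fun ⟨n, hn⟩ => ?_, fun hy => ⟨_, hy⟩⟩
    exact Module.End.pow_map_zero_of_le hle
      (Module.End.ker_pow_le_ker_pow_finrank (LieAlgebra.ad k L x) n hn)
  · rw [mem_engel_iff, ← LieAlgebra.ad_apply (R := k), hs] at hy
    obtain ⟨n, hn⟩ := hy
    exact (mem_engel_iff k x y).mpr
      ⟨n + p ^ Module.finrank k L, by rw [pow_add, Module.End.mul_apply, hn]⟩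

theorem LieAlgebra.span_isCartanSubalgebra_eq_top {k L : Type*} [Field k] [LieRing L]
    [LieAlgebra k L] [FiniteDimensional k L] {p : ℕ} (hp : 1 < p)
    (h : ∀ x : L, ∃ x' : L, (ad k L x' : Module.End k L) = ad k L x ^ p) :
    Submodule.span k {x : L | ∃ c : LieSubalgebra k L, c.IsCartanSubalgebra ∧ x ∈ c} = ⊤ := by
  induction hd : Module.finrank k L using Nat.strong_induction_on generalizing L with
  | _ d ih =>
  by_cases hL : LieRing.IsNilpotent L
  · exact Submodule.eq_top_iff'.mpr fun x =>
      Submodule.subset_span ⟨⊤, inferInstance, LieSubalgebra.mem_top x⟩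
  rw [eq_top_iff, ← span_not_isNilpotent_ad_eq_top (k := k) hL, Submodule.span_le]
  intro x hx
  set e := LieSubalgebra.engel k x
  obtain ⟨s, hs, hself⟩ := LieSubalgebra.exists_mem_engel_iff_lie_eq_zero hp h x
  have hlt : Module.finrank k e < d := by
    rw [← hd]
    refine Submodule.finrank_lt (s := e.toSubmodule) fun htop => hx ?_
    refine ⟨Module.finrank k L, LinearMap.ext fun y => ?_⟩
    have hy : y ∈ e := by
      rw [← LieSubalgebra.mem_toSubmodule, htop]
      exact Submodule.mem_top
    obtain ⟨n, hn⟩ := (LieSubalgebra.mem_engel_iff k x y).mp hy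
    exact Module.End.ker_pow_le_ker_pow_finrank (ad k L x) n hn
  have hpe : ∀ y : e, ∃ y' : e, (ad k e y' : Module.End k e) = ad k e y ^ p := by
    intro y
    obtain ⟨y', hy'⟩ := h y
    have hys : ad k L y s = 0 := by rw [ad_apply, ← lie_skew, (hs y).mp y.2, neg_zero]
    have hye : y' ∈ e := by
      rw [hs, ← lie_skew, ← ad_apply (R := k), hy',
        Module.End.pow_map_zero_of_le hp.le (by rwa [pow_one]), neg_zero]
    refine ⟨⟨y', hye⟩, LinearMap.ext fun z => Subtype.ext ?_⟩
    rw [LieSubalgebra.coe_ad_pow, ← hy']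
    rfl
  have hspan := ih _ hlt hpe rfl
  have hmap : Submodule.map e.toSubmodule.subtype ⊤ ≤
      Submodule.span k {x : L | ∃ c : LieSubalgebra k L, c.IsCartanSubalgebra ∧ x ∈ c} := by
    rw [← hspan, Submodule.map_span_le]
    rintro y ⟨H, hH, hyH⟩
    exact Submodule.subset_span ⟨H.map e.incl, LieSubalgebra.isCartanSubalgebra_map_incl hs hself H,
      (LieSubalgebra.mem_map _ _ _).mpr ⟨y, hyH, rfl⟩⟩
  exact hmap ⟨⟨x, LieSubalgebra.self_mem_engel k x⟩, Submodule.mem_top, rfl⟩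

theorem lemma4p3 (p : ℕ) [Fact p.Prime] (k : Type*) [Field k] [CharP k p]
    (g : Type*) [LieRing g] [LieAlgebra k g] [FiniteDimensional k g]
    [RestrictedLieAlgebra p k g] :
    Submodule.span k {x : g | ∃ c : LieSubalgebra k g, c.IsCartanSubalgebra ∧ x ∈ c} = ⊤ :=
  LieAlgebra.span_isCartanSubalgebra_eq_top (Fact.out : p.Prime).one_lt fun x =>
    ⟨RestrictedLieAlgebra.pMap p k x, RestrictedLieAlgebra.ad_pMap x⟩
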